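/- Let $X$ be a countably infinite circularly ordered set, with strict circular order relation $[a,b,c]$, and let $G$ be a group acting effectively on $X$ by automorphisms of the circular order. Assume that the action is ultrahomogeneous: for all finite subsets $A,B\subseteq X$, every bijection $f:A\to B$ such that $[a,b,c]\iff[f(a),f(b),f(c)]$ for all $a,b,c\in A$ is the restriction to $A$ of the action of some element of $G$. Equip $G$ with the topology of pointwise convergence on the discrete set $X$. A minimal $G$-system is a nonempty compact Hausdorff space with a continuous action $G\times Z\to Z$ all of whose orbits are dense; a factor map is a continuous $G$-equivariant surjection; and the universal minimal $G$-system $M(G)$ is the minimal $G$-system, unique up to isomorphism, that has every minimal $G$-system as a factor. Then every nontrivial factor map of $M(G)$ is almost one-to-one: if $Y$ is a compact Hausdorff space with a continuous action of $G$, having more than one point, and $\pi:M(G)\to Y$ is a factor map, then there is a dense $G_\delta$ set $Z_0\subseteq M(G)$ such that $\pi^{-1}(\pi(z))=\{z\}$ for all $z\in Z_0$. -/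

import Mathlib

open Set Topology

universe u v

/-- An action of a group `G` on a circularly ordered set `X` is *ultrahomogeneous*: `X` is infinite,
the action is effective and preserves the circular order, and every isomorphism of circular orders
between two finite subsets of `X` is the restriction of the action of some element of `G`.
(`sbtw a b c` is the strict ternary relation `[a, b, c]` of the circular order.) -/
structure IsCircularlyUltrahomogeneous (G : Type*) (X : Type*) [Group G] [CircularOrder X]
    [MulAction G X] : Prop where
  infinite : Infinite X
  effective : ∀ g : G, (∀ x : X, g • x = x) → g = 1
  smul_sbtw : ∀ (g : G) (a b c : X), sbtw a b c → sbtw (g • a) (g • b) (g • c)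
  extend : ∀ (A B : Finset X) (f : A ≃ B),
    (∀ a b c : A, sbtw (a : X) (b : X) (c : X) ↔ sbtw (f a : X) (f b : X) (f c : X)) →
    ∃ g : G, ∀ a : A, g • (a : X) = (f a : X)

/-- The topology of pointwise convergence on a group `G` acting on a set `X`, where `X` is regarded
as a discrete space: the topology induced from the product topology on `X → X` by sending `g` to
the map `x ↦ g • x`. -/
@[reducible] def pointwiseTopology (G : Type*) (X : Type*) [Group G] [MulAction G X] : TopologicalSpace G :=
  TopologicalSpace.induced (fun (g : G) (x : X) => g • x)
    (@Pi.topologicalSpace X (fun _ => X) (fun _ => ⊥))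

/-- `Z` is a *minimal `G`-system*: a nonempty compact Hausdorff space with a (jointly) continuous
action of `G`, all of whose orbits are dense. -/
structure IsMinimalSystem (G : Type*) (Z : Type*) [Group G] [TopologicalSpace G]
    [TopologicalSpace Z] [MulAction G Z] : Prop where
  nonempty : Nonempty Z
  compact : CompactSpace Z
  t2 : T2Space Z
  continuous_smul : ContinuousSMul G Z
  minimal : MulAction.IsMinimal G Z

/-- `p : Z → Y` is a *factor map* of `G`-systems: a continuous equivariant surjection. -/
structure IsFactorMap (G : Type*) {Z Y : Type*} [Group G] [TopologicalSpace Z]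
    [TopologicalSpace Y] [MulAction G Z] [MulAction G Y] (p : Z → Y) : Prop where
  continuous : Continuous p
  map_smul : ∀ (g : G) (z : Z), p (g • z) = g • p z
  surjective : Function.Surjective p

/-- `M` is (a model of) the *universal minimal `G`-system*: it is a minimal `G`-system and has every
minimal `G`-system as a factor. Every minimal `G`-system is a continuous image of the space of
ultrafilters on `G`, hence has a copy in the universe of `G`, so it is enough to test
against systems in that universe. -/
structure IsUniversalMinimalSystem (G : Type u) (M : Type v) [Group G] [TopologicalSpace G]
    [TopologicalSpace M] [MulAction G M] : Prop where
  isMinimalSystem : IsMinimalSystem G M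
  universal : ∀ (Y : Type u) [TopologicalSpace Y] [MulAction G Y], IsMinimalSystem G Y →
    ∃ p : M → Y, IsFactorMap G p

/-- Equivariant continuous maps from a system to a minimal system are factor maps. -/
theorem IsMinimalSystem.isFactorMap {G Z Y : Type*} [Group G] [TopologicalSpace G]
    [TopologicalSpace Z] [MulAction G Z] [TopologicalSpace Y] [MulAction G Y]
    (hY : IsMinimalSystem G Y) [CompactSpace Z] [Nonempty Z] {p : Z → Y} (hp : Continuous p)
    (he : ∀ (g : G) (z : Z), p (g • z) = g • p z) : IsFactorMap G p := by
  refine ⟨hp, he, ?_⟩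
  have := hY.t2
  have := hY.minimal
  obtain ⟨z⟩ := ‹Nonempty Z›
  have hd : Dense (range p) := (MulAction.dense_orbit G (p z)).mono (by
    rintro _ ⟨g, rfl⟩
    exact ⟨g • z, he g z⟩)
  have hc : IsClosed (range p) := (isCompact_range hp).isClosed
  exact range_eq_univ.1 (hc.closure_eq ▸ hd.closure_eq)

/-- Every nonempty compact system contains a minimal system. -/
theorem exists_isMinimalSystem_subset (G : Type*) (Z : Type v) [Group G] [TopologicalSpace G]
    [TopologicalSpace Z] [MulAction G Z] [CompactSpace Z] [T2Space Z] [ContinuousSMul G Z]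
    [Nonempty Z] : ∃ K : SubMulAction G Z, IsMinimalSystem G K := by
  let P : Set (Set Z) := {s | IsClosed s ∧ s.Nonempty ∧ ∀ (g : G), ∀ z ∈ s, g • z ∈ s}
  obtain ⟨m, hm⟩ : ∃ m, Minimal (fun s => s ∈ P) m := by
    refine zorn_superset P fun c hc hch => ?_
    rcases c.eq_empty_or_nonempty with rfl | hne
    · exact ⟨univ, ⟨isClosed_univ, univ_nonempty, fun _ _ _ => mem_univ _⟩, by simp⟩
    · refine ⟨⋂₀ c, ⟨isClosed_sInter fun s hs => (hc hs).1, ?_, ?_⟩, fun s hs => sInter_subset_of_mem hs⟩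
      · have : Nonempty c := hne.to_subtype
        rw [sInter_eq_iInter]
        refine IsCompact.nonempty_iInter_of_directed_nonempty_isCompact_isClosed _ ?_
          (fun s => (hc s.2).2.1) (fun s => (hc s.2).1.isCompact) (fun s => (hc s.2).1)
        intro s t
        rcases hch.total s.2 t.2 with h | h
        · exact ⟨s, subset_rfl, h⟩
        · exact ⟨t, h, subset_rfl⟩
      · intro g z hz s hs
        exact (hc hs).2.2 g z (hz s hs)
  have hmin := hm.prop
  let K : SubMulAction G Z := ⟨m, fun g {z} hz => hmin.2.2 g z hz⟩
  refine ⟨K, hmin.2.1.to_subtype, isCompact_iff_compactSpace.1 hmin.1.isCompact,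
    inferInstanceAs (T2Space m), ⟨?_⟩, ⟨fun x => ?_⟩⟩
  · exact Continuous.subtype_mk (continuous_fst.smul (continuous_subtype_val.comp continuous_snd)) _
  · have hx : closure (MulAction.orbit G (x : Z)) ⊆ m :=
      closure_minimal (by rintro _ ⟨g, rfl⟩; exact hmin.2.2 g x x.2) hmin.1
    have hle : m ⊆ closure (MulAction.orbit G (x : Z)) := by
      refine hm.le_of_le ⟨isClosed_closure, ⟨_, subset_closure (MulAction.mem_orbit_self _)⟩, ?_⟩ hx
      intro g z hz
      exact smul_closure_orbit_subset g (x : Z) (smul_mem_smul_set hz)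
    intro y
    rw [IsInducing.subtypeVal.closure_eq_preimage_closure_image]
    have : (Subtype.val '' (MulAction.orbit G x) : Set Z) = MulAction.orbit G (x : Z) := by
      ext z
      constructor
      · rintro ⟨_, ⟨g, rfl⟩, rfl⟩
        exact ⟨g, rfl⟩
      · rintro ⟨g, rfl⟩
        exact ⟨g • x, ⟨g, rfl⟩, rfl⟩
    change (y : Z) ∈ closure (Subtype.val '' (MulAction.orbit G x) : Set Z)
    rw [this]
    exact hle y.2

/-- The universal minimal system exists, for every group with a topology. -/
theorem exists_isUniversalMinimalSystem (G : Type u) [Group G] [TopologicalSpace G] :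
    ∃ (M : Type u) (_ : TopologicalSpace M) (_ : MulAction G M),
      IsUniversalMinimalSystem G M := by
  let I := {i : Σ s : Setoid (Ultrafilter G), TopologicalSpace (Quotient s) × MulAction G (Quotient s) //
    @IsMinimalSystem G (Quotient i.1) _ _ i.2.1 i.2.2}
  let F : I → Type u := fun i => Quotient i.1.1
  let (i : I) : TopologicalSpace (F i) := i.1.2.1
  let (i : I) : MulAction G (F i) := i.1.2.2
  have hF (i : I) : IsMinimalSystem G (F i) := i.2
  have (i : I) := (hF i).nonempty
  have (i : I) := (hF i).compact
  have (i : I) := (hF i).t2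
  have (i : I) := (hF i).continuous_smul
  obtain ⟨K, hK⟩ := exists_isMinimalSystem_subset G (∀ i, F i)
  refine ⟨K, inferInstance, inferInstance, hK, fun Y _ _ hY => ?_⟩
  have := hY.t2
  have := hY.compact
  have := hY.minimal
  have := hK.compact
  have := hK.nonempty
  obtain ⟨y⟩ := hY.nonempty
  let e : Ultrafilter G → Y := Ultrafilter.extend fun g => g • y
  have hes : Function.Surjective e := by
    have hd : Dense (range e) := (MulAction.dense_orbit G y).mono (by
      rintro _ ⟨g, rfl⟩
      exact ⟨pure g, ultrafilter_extend_pure _ g⟩)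
    have hc : IsClosed (range e) := (isCompact_range (continuous_ultrafilter_extend _)).isClosed
    exact range_eq_univ.1 (hc.closure_eq ▸ hd.closure_eq)
  let q : Quotient (Setoid.ker e) ≃ Y := Setoid.quotientKerEquivOfSurjective e hes
  let tq : TopologicalSpace (Quotient (Setoid.ker e)) := TopologicalSpace.induced q ‹_›
  let aq : MulAction G (Quotient (Setoid.ker e)) := q.mulAction G
  have hq (g : G) (z : Quotient (Setoid.ker e)) : q (g • z) = g • q z := by
    simp [Equiv.smul_def]
  let h : Quotient (Setoid.ker e) ≃ₜ Y := q.toHomeomorphOfIsInducing ⟨rfl⟩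
  have hmin : IsMinimalSystem G (Quotient (Setoid.ker e)) := by
    refine ⟨⟨q.symm y⟩, h.symm.compactSpace, h.symm.t2Space, ⟨?_⟩, ⟨fun x => ?_⟩⟩
    · rw [h.isInducing.continuous_iff]
      have : ContinuousSMul G Y := hY.continuous_smul
      have hcont : Continuous fun p : G × Quotient (Setoid.ker e) => p.1 • h p.2 :=
        continuous_fst.smul (h.continuous.comp continuous_snd)
      exact hcont.congr fun p => (hq p.1 p.2).symm
    · have := (MulAction.dense_orbit G (q x)).preimage h.isOpenMap
      refine this.mono ?_
      rintro z ⟨g, hg⟩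
      exact ⟨g, q.injective ((hq g x).trans hg)⟩
  let i : I := ⟨⟨Setoid.ker e, tq, aq⟩, hmin⟩
  refine ⟨fun k => h (k.1 i), hY.isFactorMap ?_ ?_⟩
  · exact h.continuous.comp ((continuous_apply i).comp continuous_subtype_val)
  · intro g z
    exact hq g (z.1 i)

/-! Fix `x : X`. Its stabilizer realises every increasing bijection between finite subsets of the
linear order `Cut x`, so Ramsey's theorem gives it a fixed point in each nonempty compact system
(`exists_fixed`). Translating that point yields an equivariant `f : X → M`, with dense range by
minimality.

If `z ≠ z'`, some finite `F` has a pointwise stabilizer that moves no point near `z` to a point near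
`z'`. That stabilizer is transitive on each arc missing `F`, so the image of such an arc cannot
accumulate at both (`exists_finset_separating`). Hence `f` has at most one limit at each point from
each side. The values and one-sided limits of `f` form a countable set, whose complement is a dense
Gδ by Baire. A point `z` of this complement and any `z' ≠ z` are limits of `f` along two disjoint
arcs (`exists_separating`).

If `p z = p z'`, then `p ∘ f` has a common limit along these arcs. All pairs of disjoint arcs with
four distinct endpoints are conjugate, while two distinct points of `Y` produce such a pair with
images having disjoint closures (`subsingleton_of_mem_closure`). -/

section CircularOrder

/-! ### Cut linear orders and finite homogeneity -/

variable {G X : Type*} [Group G] [CircularOrder X] [MulAction G X]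

theorem sbtw_or_sbtw_of_ne {a b c : X} (hab : a ≠ b) (hbc : b ≠ c) (hca : c ≠ a) :
    sbtw a b c ∨ sbtw c b a := by
  by_contra! h
  rcases btw_antisymm (btw_iff_not_sbtw.2 h.2) (btw_iff_not_sbtw.2 h.1) with h | h | h
  exacts [hab h, hbc h, hca h]

theorem SBtw.sbtw.ne₁₂ {a b c : X} (h : sbtw a b c) : a ≠ b := by
  rintro rfl; exact sbtw_irrefl_left h

theorem SBtw.sbtw.ne₂₃ {a b c : X} (h : sbtw a b c) : b ≠ c := by
  rintro rfl; exact sbtw_irrefl_right h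

theorem SBtw.sbtw.ne₃₁ {a b c : X} (h : sbtw a b c) : c ≠ a := by
  rintro rfl; exact sbtw_irrefl_left_right h

/-- The circularly ordered set `X` cut open at the point `x`, which is removed. -/
def Cut (x : X) : Type _ := {y : X // y ≠ x}

noncomputable instance (x : X) : LinearOrder (Cut x) where
  le a b := a = b ∨ sbtw x a.1 b.1
  lt a b := sbtw x a.1 b.1
  le_refl a := Or.inl rfl
  le_trans a b c := by
    rintro (rfl | h) (rfl | h')
    exacts [Or.inl rfl, Or.inr h', Or.inr h, Or.inr (h.trans_right h')]
  le_antisymm a b := by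
    rintro (rfl | h) (h' | h')
    exacts [rfl, rfl, h'.symm, (h.not_sbtw h'.cyclic_left).elim]
  lt_iff_le_not_ge a b := by
    constructor
    · refine fun h => ⟨Or.inr h, ?_⟩
      rintro (rfl | h')
      · exact sbtw_irrefl_right h
      · exact h.not_sbtw h'.cyclic_left
    · rintro ⟨rfl | h, h'⟩
      · exact (h' (Or.inl rfl)).elim
      · exact h
  le_total a b := by
    by_cases hab : a = b
    · exact Or.inl (Or.inl hab)
    · rcases sbtw_or_sbtw_of_ne a.2.symm (fun h => hab (Subtype.ext h)) b.2 with h | h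
      · exact Or.inl (Or.inr h)
      · exact Or.inr (Or.inr h.cyclic_right)
  toDecidableLE := Classical.decRel _

theorem Cut.lt_iff {x : X} {a b : Cut x} : a < b ↔ sbtw x a.1 b.1 := Iff.rfl

theorem Cut.sbtw_of_lt {x : X} {a b c : Cut x} (hab : a < b) (hbc : b < c) :
    sbtw a.1 b.1 c.1 :=
  (SBtw.sbtw.trans_left (SBtw.sbtw.cyclic_right hbc) hab).cyclic_left

theorem Cut.sbtw_iff {x : X} {a b c : Cut x} :
    sbtw a.1 b.1 c.1 ↔ (a < b ∧ b < c) ∨ (b < c ∧ c < a) ∨ (c < a ∧ a < b) := by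
  constructor
  · intro h
    have h1 : a ≠ b := fun e => h.ne₁₂ (congrArg _ e)
    have h2 : b ≠ c := fun e => h.ne₂₃ (congrArg _ e)
    have h3 : c ≠ a := fun e => h.ne₃₁ (congrArg _ e)
    rcases h1.lt_or_gt with h1 | h1 <;> rcases h2.lt_or_gt with h2 | h2 <;>
      rcases h3.lt_or_gt with h3 | h3 <;> try tauto
    -- In the four surviving patterns at most one of `a < b`, `b < c`, `c < a` holds, so the
    -- reversed triple is in circular order.
    · exact (h.not_sbtw (Cut.sbtw_of_lt h3 h2).cyclic_left).elim
    · exact (h.not_sbtw (Cut.sbtw_of_lt h1 h3).cyclic_right).elim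
    · exact (h.not_sbtw (Cut.sbtw_of_lt h2 h1)).elim
    · exact (h.not_sbtw (Cut.sbtw_of_lt h2 h1)).elim
  · rintro (⟨h, h'⟩ | ⟨h, h'⟩ | ⟨h, h'⟩)
    · exact Cut.sbtw_of_lt h h'
    · exact (Cut.sbtw_of_lt h h').cyclic_right
    · exact (Cut.sbtw_of_lt h h').cyclic_left

namespace IsCircularlyUltrahomogeneous

/-- One implication suffices: a triple of distinct points has exactly one of two orientations, so
preserving orientation also reflects it. -/
theorem exists_smul_eq (hX : IsCircularlyUltrahomogeneous G X) {ι : Type*} [Finite ι]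
    {u v : ι → X} (hu : u.Injective) (hv : v.Injective)
    (h : ∀ i j k, sbtw (u i) (u j) (u k) → sbtw (v i) (v j) (v k)) :
    ∃ g : G, ∀ i, g • u i = v i := by
  classical
  have := Fintype.ofFinite ι
  let eu : ι ≃ (Finset.univ.map ⟨u, hu⟩ : Finset X) :=
    Equiv.ofBijective (fun i => ⟨u i, by simp⟩)
      ⟨fun i j hij => hu (congrArg Subtype.val hij), by rintro ⟨y, hy⟩; simpa using hy⟩
  let ev : ι ≃ (Finset.univ.map ⟨v, hv⟩ : Finset X) :=
    Equiv.ofBijective (fun i => ⟨v i, by simp⟩)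
      ⟨fun i j hij => hv (congrArg Subtype.val hij), by rintro ⟨y, hy⟩; simpa using hy⟩
  obtain ⟨g, hg⟩ := hX.extend _ _ (eu.symm.trans ev) (by
    intro a b c
    obtain ⟨i, rfl⟩ := eu.surjective a
    obtain ⟨j, rfl⟩ := eu.surjective b
    obtain ⟨k, rfl⟩ := eu.surjective c
    simp only [Equiv.trans_apply, Equiv.symm_apply_apply]
    change sbtw (u i) (u j) (u k) ↔ sbtw (v i) (v j) (v k)
    refine ⟨h i j k, fun h' => ?_⟩
    by_contra hn
    rcases sbtw_or_sbtw_of_ne (a := u i) (b := u j) (c := u k) (fun e => h'.ne₁₂ (by rw [hu e]))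
      (fun e => h'.ne₂₃ (by rw [hu e])) (fun e => h'.ne₃₁ (by rw [hu e])) with h1 | h1
    · exact hn h1
    · exact h'.not_sbtw (h _ _ _ h1))
  refine ⟨g, fun i => ?_⟩
  have := hg (eu i)
  rwa [Equiv.trans_apply, Equiv.symm_apply_apply] at this

/-- Two points contain no triple of distinct points, so the order condition is vacuous. -/
theorem exists_smul_pair (hX : IsCircularlyUltrahomogeneous G X) {a b c d : X} (hab : a ≠ b)
    (hcd : c ≠ d) : ∃ g : G, g • a = c ∧ g • b = d := by
  obtain ⟨g, hg⟩ := hX.exists_smul_eq (ι := Bool) (u := fun i => cond i a b)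
    (v := fun i => cond i c d)
    (by rintro (_ | _) (_ | _) h <;> simp_all)
    (by rintro (_ | _) (_ | _) h <;> simp_all)
    (by
      intro i j k h
      exfalso
      have h1 := h.ne₁₂
      have h2 := h.ne₂₃
      have h3 := h.ne₃₁
      cases i <;> cases j <;> cases k <;> simp_all)
  exact ⟨g, hg true, hg false⟩

theorem exists_smul_point (hX : IsCircularlyUltrahomogeneous G X) (a c : X) :
    ∃ g : G, g • a = c := by
  have := hX.infinite
  obtain ⟨b, hb⟩ := exists_ne a
  obtain ⟨d, hd⟩ := exists_ne c
  obtain ⟨g, hg, -⟩ := hX.exists_smul_pair hb.symm hd.symm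
  exact ⟨g, hg⟩

/-- Some arc is nonempty because `X` has three points, and double transitivity carries it to any
other arc. -/
theorem exists_sbtw (hX : IsCircularlyUltrahomogeneous G X) {a b : X} (hab : a ≠ b) :
    ∃ c, sbtw a c b := by
  have := hX.infinite
  obtain ⟨p, q, r, h⟩ : ∃ p q r : X, sbtw p q r := by
    obtain ⟨c, hc⟩ := (toFinite {a, b}).exists_notMem
    simp only [mem_insert_iff, mem_singleton_iff, not_or] at hc
    rcases sbtw_or_sbtw_of_ne hab (Ne.symm hc.2) hc.1 with h | h
    exacts [⟨_, _, _, h⟩, ⟨_, _, _, h⟩]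
  obtain ⟨g, rfl, rfl⟩ := hX.exists_smul_pair h.ne₃₁.symm hab
  exact ⟨_, hX.smul_sbtw g _ _ _ h⟩

theorem nonempty_cut (hX : IsCircularlyUltrahomogeneous G X) (x : X) : Nonempty (Cut x) := by
  have := hX.infinite
  obtain ⟨y, hy⟩ := exists_ne x
  exact ⟨⟨y, hy⟩⟩

theorem noMaxOrder_cut (hX : IsCircularlyUltrahomogeneous G X) (x : X) : NoMaxOrder (Cut x) := by
  refine ⟨fun a => ?_⟩
  obtain ⟨c, hc⟩ := hX.exists_sbtw a.2
  exact ⟨⟨c, hc.ne₂₃⟩, hc.cyclic_right⟩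

theorem noMinOrder_cut (hX : IsCircularlyUltrahomogeneous G X) (x : X) : NoMinOrder (Cut x) := by
  refine ⟨fun a => ?_⟩
  obtain ⟨c, hc⟩ := hX.exists_sbtw a.2.symm
  exact ⟨⟨c, hc.ne₁₂.symm⟩, hc⟩

/-- Strictly increasing finite families in `Cut x` are conjugate under the stabilizer of `x`. -/
theorem exists_smul_eq_of_strictMono (hX : IsCircularlyUltrahomogeneous G X) {x : X}
    {ι : Type*} [LinearOrder ι] [Finite ι] {u v : ι → Cut x} (hu : StrictMono u)
    (hv : StrictMono v) : ∃ g : G, g • x = x ∧ ∀ i, g • (u i).1 = (v i).1 := by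
  have hinj {u : ι → Cut x} (hu : StrictMono u) :
      Function.Injective fun i : Option ι => i.elim x (fun i => (u i).1) := by
    rintro (_ | i) (_ | j) h
    · rfl
    · exact ((u j).2 h.symm).elim
    · exact ((u i).2 h).elim
    · exact congrArg some (hu.injective (Subtype.ext h))
  obtain ⟨g, hg⟩ := hX.exists_smul_eq (hinj hu) (hinj hv) (by
      have key {i j : ι} (h : sbtw x (u i).1 (u j).1) : sbtw x (v i).1 (v j).1 :=
        hv (hu.lt_iff_lt.1 h)
      rintro (_ | i) (_ | j) (_ | k) h
      · exact (sbtw_irrefl _ h).elim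
      · exact (sbtw_irrefl_left h).elim
      · exact (sbtw_irrefl_left_right h).elim
      · exact key h
      · exact (sbtw_irrefl_right h).elim
      · exact (key (sbtw_cyclic_left h)).cyclic_right
      · exact (key (sbtw_cyclic_right h)).cyclic_left
      · have : sbtw (u i).1 (u j).1 (u k).1 := h
        change sbtw (v i).1 (v j).1 (v k).1
        simpa only [Cut.sbtw_iff, hu.lt_iff_lt, hv.lt_iff_lt] using this)
  exact ⟨g, hg none, fun i => hg (some i)⟩

/-- The pointwise stabilizer of a finite set acts transitively on the complementary intervals. -/
theorem exists_smul_eq_of_mem_cIoo (hX : IsCircularlyUltrahomogeneous G X) {F : Finset X}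
    {a b : X} (hF : ∀ f ∈ F, ¬ sbtw a f b) {y z : X} (hy : sbtw a y b) (hz : sbtw a z b) :
    ∃ g : G, (∀ f ∈ F, g • f = f) ∧ g • y = z := by
  have key {y z : X} (hy : sbtw a y b) (hz : sbtw a z b) {f k : X} (hf : f ∈ F) (hk : k ∈ F)
      (h : sbtw y f k) : sbtw z f k := by
    have hzk : z ≠ k := by rintro rfl; exact hF _ hk hz
    have hzf : z ≠ f := by rintro rfl; exact hF _ hf hz
    -- Cut at `a`, every other point of `F` is at least `b`, hence above `y`.
    have lt_of {y : X} (hy : sbtw a y b) {f : X} (hf : f ∈ F) (hfa : f ≠ a) (hyf : y ≠ f) :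
        sbtw a y f := by
      rcases sbtw_or_sbtw_of_ne hy.ne₁₂ hyf hfa with h | h
      · exact h
      · exact (hF f hf (h.cyclic_right.trans_right hy)).elim
    by_cases hfa : f = a
    · subst hfa
      exact (h.not_sbtw (lt_of hy hk h.ne₂₃.symm h.ne₃₁.symm).cyclic_right).elim
    · by_cases hka : k = a
      · subst hka
        exact (lt_of hz hf hfa hzf).cyclic_left
      · have h1 := lt_of hy hf hfa h.ne₁₂
        have h2 := lt_of hz hf hfa hzf
        have h3 := lt_of hy hk hka h.ne₃₁.symm
        have h4 := lt_of hz hk hka hzk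
        have h5 : sbtw a f k := by
          refine (sbtw_or_sbtw_of_ne (Ne.symm hfa) h.ne₂₃ hka).resolve_right fun h' => ?_
          exact h.not_sbtw (Cut.sbtw_of_lt (x := a) (a := ⟨y, hy.ne₁₂.symm⟩) (b := ⟨k, hka⟩)
            (c := ⟨f, hfa⟩) h3 h'.cyclic_right).cyclic_left
        exact Cut.sbtw_of_lt (x := a) (a := ⟨z, hz.ne₁₂.symm⟩) (b := ⟨f, hfa⟩) (c := ⟨k, hka⟩) h2 h5
  obtain ⟨g, hg⟩ := hX.exists_smul_eq (ι := Option F)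
    (u := fun i => i.elim y (fun i => i.1)) (v := fun i => i.elim z (fun i => i.1))
    (by
      rintro (_ | i) (_ | j) h
      · rfl
      · exact (hF _ j.2 ((show y = j.1 from h) ▸ hy)).elim
      · exact (hF _ i.2 ((show i.1 = y from h) ▸ hy)).elim
      · exact congrArg some (Subtype.ext h))
    (by
      rintro (_ | i) (_ | j) h
      · rfl
      · exact (hF _ j.2 ((show z = j.1 from h) ▸ hz)).elim
      · exact (hF _ i.2 ((show i.1 = z from h) ▸ hz)).elim
      · exact congrArg some (Subtype.ext h))
    (by
      rintro (_ | i) (_ | j) (_ | k) h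
      · exact (sbtw_irrefl _ h).elim
      · exact (sbtw_irrefl_left h).elim
      · exact (sbtw_irrefl_left_right h).elim
      · exact key hy hz j.2 k.2 h
      · exact (sbtw_irrefl_right h).elim
      · exact (key hy hz k.2 i.2 h.cyclic_left).cyclic_right
      · exact (key hy hz i.2 j.2 h.cyclic_right).cyclic_left
      · exact h)
  exact ⟨g, fun f hf => hg (some ⟨f, hf⟩), hg none⟩

end IsCircularlyUltrahomogeneous

end CircularOrder

/-- The infinite Ramsey theorem for colourings of the `k`-element subsets of `ℕ`. -/
theorem exists_infinite_subset_monochromatic {κ : Type*} [Finite κ] (k : ℕ) :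
    ∀ (c : Finset ℕ → κ) (A : Set ℕ), A.Infinite → ∃ H ⊆ A, H.Infinite ∧
      ∃ a : κ, ∀ s : Finset ℕ, (s : Set ℕ) ⊆ H → s.card = k → c s = a := by
  induction k with
  | zero =>
    intro c A hA
    exact ⟨A, subset_rfl, hA, c ∅, fun s _ hs => by rw [Finset.card_eq_zero.1 hs]⟩
  | succ k ih =>
    intro c A hA
    -- Split off a point `a` and thin out the rest so that the colour of `insert a s` depends on `a`
    -- alone. Iterating, the colour of a set depends only on its least element, and pigeonhole
    -- finishes.
    have step (B : {B : Set ℕ // B.Infinite}) : ∃ (a : ℕ) (B' : {B : Set ℕ // B.Infinite}) (q : κ),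
        a ∈ B.1 ∧ B'.1 ⊆ B.1 ∧ (∀ b ∈ B'.1, a < b) ∧
        ∀ s : Finset ℕ, (s : Set ℕ) ⊆ B'.1 → s.card = k → c (insert a s) = q := by
      obtain ⟨a, ha⟩ := B.2.nonempty
      obtain ⟨H, hH, hi, q, hq⟩ := ih (fun s => c (insert a s)) (B.1 \ Iic a)
        (B.2.sdiff (finite_Iic a))
      exact ⟨a, ⟨H, hi⟩, q, ha, fun b hb => (hH hb).1, fun b hb => not_le.1 (hH hb).2, hq⟩
    choose pt nxt col hpt hnxt hlt hcol using step
    let Bs : ℕ → {B : Set ℕ // B.Infinite} := fun n => Nat.rec ⟨A, hA⟩ (fun _ B => nxt B) n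
    have hBs (n : ℕ) : Bs (n + 1) = nxt (Bs n) := rfl
    have hanti : Antitone fun n => (Bs n).1 := antitone_nat_of_succ_le fun n => hnxt (Bs n)
    have hmono : StrictMono fun n => pt (Bs n) :=
      strictMono_nat_of_lt_succ fun n => hlt (Bs n) _ (hpt (Bs (n + 1)))
    obtain ⟨q, hq⟩ := Finite.exists_infinite_fiber fun n => col (Bs n)
    refine ⟨(fun n => pt (Bs n)) '' ((fun n => col (Bs n)) ⁻¹' {q}), ?_, ?_, q, ?_⟩
    · rintro _ ⟨n, -, rfl⟩
      exact hanti (Nat.zero_le n) (hpt (Bs n))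
    · exact (infinite_coe_iff.1 hq).image hmono.injective.injOn
    · intro s hs hk
      have hne : s.Nonempty := Finset.card_pos.1 (by omega)
      obtain ⟨n, hn, hmin⟩ := hs (s.min'_mem hne)
      have hn' : col (Bs n) = q := hn
      rw [← hn', ← hcol (Bs n) (s.erase (pt (Bs n))) ?_ ?_, Finset.insert_erase]
      · change pt (Bs n) = _ at hmin
        rw [hmin]
        exact s.min'_mem hne
      · intro b hb
        obtain ⟨hb1, hb2⟩ := Finset.mem_erase.1 (Finset.mem_coe.1 hb)
        obtain ⟨j, -, rfl⟩ := hs hb2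
        have h1 : pt (Bs n) < pt (Bs j) :=
          lt_of_le_of_ne (hmin.trans_le (s.min'_le _ hb2)) hb1.symm
        exact hanti (Nat.succ_le_of_lt (hmono.lt_iff_lt.1 h1)) (hpt (Bs j))
      · rw [Finset.card_erase_of_mem, hk, Nat.add_sub_cancel]
        change pt (Bs n) = _ at hmin
        rw [hmin]
        exact s.min'_mem hne

/-! ### Small group elements move compact sets little -/

section Pointwise

variable {G X : Type*} [Group G] [MulAction G X] [TopologicalSpace G]

theorem exists_finset_of_mem_nhds_one (hG : ‹TopologicalSpace G› = pointwiseTopology G X)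
    {V : Set G} (hV : V ∈ 𝓝 (1 : G)) :
    ∃ F : Finset X, ∀ g : G, (∀ f ∈ F, g • f = f) → g ∈ V := by
  subst hG
  let _ : TopologicalSpace X := ⊥
  have : DiscreteTopology X := ⟨rfl⟩
  rw [nhds_induced, nhds_pi] at hV
  obtain ⟨W, hW, hWV⟩ := hV
  obtain ⟨I, hI, t, ht, htW⟩ := Filter.mem_pi.1 hW
  refine ⟨hI.toFinset, fun g hg => hWV (htW fun i hi => ?_)⟩
  change g • i ∈ t i
  rw [hg i (hI.mem_toFinset.2 hi)]
  simpa using mem_of_mem_nhds (ht i)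

theorem exists_finset_smul_subset (hG : ‹TopologicalSpace G› = pointwiseTopology G X)
    {M : Type*} [TopologicalSpace M] [MulAction G M] [ContinuousSMul G M]
    {C U : Set M} (hC : IsCompact C) (hU : IsOpen U) (hCU : C ⊆ U) :
    ∃ F : Finset X, ∀ g : G, (∀ f ∈ F, g • f = f) → ∀ w ∈ C, g • w ∈ U := by
  obtain ⟨V, W, hV, -, h1, hCW, h⟩ := generalized_tube_lemma (isCompact_singleton (x := (1 : G))) hC
    (hU.preimage (continuous_smul (M := G) (X := M))) (by
      rintro ⟨g, w⟩ ⟨rfl, hw⟩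
      simpa using hCU hw)
  obtain ⟨F, hF⟩ := exists_finset_of_mem_nhds_one hG (hV.mem_nhds (h1 rfl))
  exact ⟨F, fun g hg w hw => h (mk_mem_prod (hF g hg) (hCW hw))⟩

open scoped Uniformity in
theorem exists_finset_smul_mem_uniformity (hG : ‹TopologicalSpace G› = pointwiseTopology G X)
    {M : Type*} [UniformSpace M] [CompactSpace M] [MulAction G M] [ContinuousSMul G M]
    {E : Set (M × M)} (hE : E ∈ 𝓤 M) :
    ∃ F : Finset X, ∀ g : G, (∀ f ∈ F, g • f = f) → ∀ w : M, (w, g • w) ∈ E := by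
  obtain ⟨E', ⟨hE', hEo⟩, hE'E⟩ := uniformity_hasBasis_open.mem_iff.1 hE
  have hcont : Continuous fun q : G × M => (q.2, q.1 • q.2) :=
    continuous_snd.prodMk continuous_smul
  obtain ⟨V, W, hV, -, h1, hCW, h⟩ := generalized_tube_lemma (isCompact_singleton (x := (1 : G)))
    (isCompact_univ (X := M)) (hEo.preimage hcont) (by
      rintro ⟨g, w⟩ ⟨rfl, -⟩
      simpa using refl_mem_uniformity hE')
  obtain ⟨F, hF⟩ := exists_finset_of_mem_nhds_one hG (hV.mem_nhds (h1 rfl))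
  exact ⟨F, fun g hg w => hE'E (h (mk_mem_prod (hF g hg) (hCW trivial)))⟩

end Pointwise

/-! ### Fixed points of point stabilizers -/

namespace IsCircularlyUltrahomogeneous

variable {G X : Type*} [Group G] [CircularOrder X] [MulAction G X] [TopologicalSpace G]

open scoped Uniformity SetRel in
-- For `h` fixing `x`, the point `h⁻¹ • m` depends, up to `E₂`, only on where `h` sends `F`. This
-- colours finite sets of positions; Ramsey makes the colour constant on `N`. If `h` sends `F` and
-- all `g⁻¹ • F` into positions in `N`, then all `g • h⁻¹ • m = (h * g⁻¹)⁻¹ • m` are close to one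
-- point.
theorem exists_almost_fixed (hX : IsCircularlyUltrahomogeneous G X)
    (hG : ‹TopologicalSpace G› = pointwiseTopology G X)
    {M : Type*} [UniformSpace M] [CompactSpace M] [Nonempty M] [MulAction G M] [ContinuousSMul G M]
    (x : X) {S : Set G} (hS : S.Finite) (hSx : ∀ g ∈ S, g • x = x) {E : Set (M × M)}
    (hE : E ∈ 𝓤 M) : ∃ w : M, ∀ g ∈ S, (w, g • w) ∈ E := by
  classical
  obtain ⟨E₁, hE₁, hs₁, hE₁E⟩ := comp_symm_mem_uniformity_sets hE
  obtain ⟨E₂, hE₂, hs₂, hE₂E₁⟩ := comp_symm_mem_uniformity_sets hE₁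
  obtain ⟨m⟩ := ‹Nonempty M›
  obtain ⟨T, hT, hTc⟩ := (isCompact_univ (X := M)).totallyBounded E₂ hE₂
  have hcol (z : M) : ∃ q : T, (z, q.1) ∈ E₂ := by
    obtain ⟨q, hq, hz⟩ := mem_iUnion₂.1 (hTc (mem_univ z))
    exact ⟨⟨q, hq⟩, hz⟩
  choose col hcol using hcol
  have : Finite T := hT
  obtain ⟨F, hF⟩ := exists_finset_smul_mem_uniformity hG hE₂
  have hval : Function.Injective (Subtype.val : Cut x → X) := Subtype.val_injective
  let F₀ : Finset (Cut x) := (F.finite_toSet.preimage hval.injOn).toFinset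
  have hF₀ (y : Cut x) : y ∈ F₀ ↔ y.1 ∈ F := Set.Finite.mem_toFinset _
  have := hX.nonempty_cut x
  have := hX.noMaxOrder_cut x
  obtain ⟨t, ht⟩ := Nat.exists_strictMono (Cut x)
  let P (s : Finset ℕ) (h : G) : Prop := h • x = x ∧ ∃ v : F₀ → ℕ, StrictMono v ∧
    range v = s ∧ ∀ i, h • i.1.1 = (t (v i)).1
  -- The `else` value is harmless: below, the colour is unfolded only at sets where `P` is
  -- satisfiable.
  let c : Finset ℕ → T := fun s => if h : ∃ h, P s h then col (h.choose⁻¹ • m) else col m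
  obtain ⟨N, -, hN, q, hq⟩ := exists_infinite_subset_monochromatic F₀.card c univ infinite_univ
  have hDfin : {y : Cut x | ∃ g ∈ insert 1 S, g • y.1 ∈ F}.Finite := by
    have : {y : Cut x | ∃ g ∈ insert 1 S, g • y.1 ∈ F} =
        ⋃ g ∈ insert 1 S, (fun y : Cut x => g • y.1) ⁻¹' F := by
      ext; simp
    rw [this]
    refine (hS.insert 1).biUnion fun g _ => F.finite_toSet.preimage ?_
    exact ((MulAction.injective g).comp hval).injOn
  let D := hDfin.toFinset
  have : Infinite N := hN.to_subtype
  let u : D → ℕ := fun i => Nat.orderEmbeddingOfSet N ((D.orderIsoOfFin rfl).symm i).1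
  have hu : StrictMono u := fun i j hij =>
    (Nat.orderEmbeddingOfSet N).strictMono ((D.orderIsoOfFin rfl).symm.strictMono hij)
  have huN (i : D) : u i ∈ N := Nat.orderEmbeddingOfSet_range N ▸ mem_range_self _
  obtain ⟨h, hx, hh⟩ := hX.exists_smul_eq_of_strictMono (u := fun i : D => i.1)
    (v := fun i => t (u i)) (fun _ _ h => h) (ht.comp hu)
  have main (g : G) (hg : g ∈ insert 1 S) : (g • h⁻¹ • m, q.1) ∈ E₁ := by
    have hgx : g • x = x := by
      rcases hg with rfl | hg
      exacts [one_smul _ _, hSx g hg]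
    have hgx' : g⁻¹ • x = x := by rw [inv_smul_eq_iff, hgx]
    let r (i : F₀) : D := ⟨⟨g⁻¹ • i.1.1, fun e => i.1.2 (by rw [inv_smul_eq_iff, hgx] at e; exact e)⟩,
      hDfin.mem_toFinset.2 ⟨g, hg, by simpa using (hF₀ _).1 i.2⟩⟩
    have hr : StrictMono r := fun i j hij => by
      change sbtw x (g⁻¹ • i.1.1) (g⁻¹ • j.1.1)
      have := hX.smul_sbtw g⁻¹ _ _ _ (show sbtw x i.1.1 j.1.1 from hij)
      rwa [hgx'] at this
    let v : F₀ → ℕ := fun i => u (r i)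
    have hv : StrictMono v := hu.comp hr
    have hP : ∃ h, P (Finset.univ.image v) h :=
      ⟨h * g⁻¹, by rw [mul_smul, hgx', hx], v, hv, by simp, fun i => by
        rw [mul_smul]; exact hh (r i)⟩
    have hc : c (Finset.univ.image v) = q := hq _
      (by
        intro b hb
        simp only [Finset.coe_image, Finset.coe_univ, image_univ] at hb
        obtain ⟨i, rfl⟩ := hb
        exact huN _)
      (by rw [Finset.card_image_of_injective _ hv.injective]; simp)
    simp only [c, dif_pos hP] at hc
    obtain ⟨h1, v', hv', hr', h2⟩ := hP.choose_spec
    set h' := hP.choose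
    -- An increasing map is determined by its range, so `h'` and `h * g⁻¹` agree on `F`.
    obtain rfl : v' = v := (StrictMono.range_inj hv' hv).1 (by rw [hr']; simp)
    have hfix : ∀ f ∈ F, (h'⁻¹ * h * g⁻¹) • f = f := by
      intro f hf
      rw [mul_smul, mul_smul, inv_smul_eq_iff]
      by_cases hfx : f = x
      · rw [hfx, hgx', hx, h1]
      · exact (hh (r ⟨⟨f, hfx⟩, (hF₀ _).2 hf⟩)).trans (h2 ⟨⟨f, hfx⟩, (hF₀ _).2 hf⟩).symm
    refine hE₂E₁ ⟨h'⁻¹ • m, ?_, ?_⟩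
    · simpa [mul_smul] using hF _ hfix (g • h⁻¹ • m)
    · rw [← hc]
      exact hcol _
  refine ⟨h⁻¹ • m, fun g hg => hE₁E ⟨q, ?_, ?_⟩⟩
  · simpa using main 1 (mem_insert _ _)
  · exact hs₁.symm _ _ (main g (mem_insert_of_mem _ hg))

/-- The stabilizer of a point is extremely amenable. -/
theorem exists_fixed (hX : IsCircularlyUltrahomogeneous G X)
    (hG : ‹TopologicalSpace G› = pointwiseTopology G X)
    (M : Type*) [TopologicalSpace M] [CompactSpace M] [T2Space M] [Nonempty M] [MulAction G M]
    [ContinuousSMul G M] (x : X) : ∃ m : M, ∀ g : G, g • x = x → g • m = m := by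
  let _ : UniformSpace M := uniformSpaceOfCompactR1
  -- Closed entourages make the sets of almost fixed points closed, so compactness applies.
  let ι := {r : G × Set (M × M) // r.1 • x = x ∧ r.2 ∈ uniformity M ∧ IsClosed r.2}
  have key : (⋂ i : ι, {w : M | (w, i.1.1 • w) ∈ i.1.2}).Nonempty := by
    refine CompactSpace.iInter_nonempty (fun i => ?_) fun s => ?_
    · exact i.2.2.2.preimage (continuous_id.prodMk (continuous_const_smul i.1.1))
    · obtain ⟨w, hw⟩ := hX.exists_almost_fixed hG (M := M) x
        (S := (fun i : ι => i.1.1) '' s) (s.finite_toSet.image _)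
        (by rintro _ ⟨i, -, rfl⟩; exact i.2.1) (E := ⋂ i ∈ s, i.1.2)
        ((Filter.biInter_finset_mem s).2 fun i _ => i.2.2.1)
      refine ⟨w, mem_iInter₂.2 fun i hi => ?_⟩
      exact mem_iInter₂.1 (hw _ (mem_image_of_mem _ hi)) i hi
  obtain ⟨m, hm⟩ := key
  refine ⟨m, fun g hg => ?_⟩
  by_contra hne
  obtain ⟨E, ⟨hE, hEc⟩, hmE⟩ : ∃ E : Set (M × M), (E ∈ uniformity M ∧ IsClosed E) ∧
      (m, g • m) ∉ E := by
    by_contra! hall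
    refine hne (eq_of_uniformity_basis uniformity_hasBasis_closed fun {E} hE => hall E hE).symm
  exact hmE (mem_iInter.1 hm ⟨(g, E), hg, hE, hEc⟩)

/-- A compact system carries an equivariant map from `X`. -/
theorem exists_equivariant (hX : IsCircularlyUltrahomogeneous G X)
    (hG : ‹TopologicalSpace G› = pointwiseTopology G X)
    (M : Type*) [TopologicalSpace M] [CompactSpace M] [T2Space M] [Nonempty M] [MulAction G M]
    [ContinuousSMul G M] : ∃ f : X → M, ∀ (g : G) (x : X), f (g • x) = g • f x := by
  have := hX.infinite
  obtain ⟨x⟩ : Nonempty X := inferInstance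
  obtain ⟨m, hm⟩ := hX.exists_fixed hG M x
  choose s hs using hX.exists_smul_point x
  -- Two elements carrying `x` to the same point differ by the stabilizer of `x`, which fixes `m`.
  refine ⟨fun y => s y • m, fun g y => ?_⟩
  rw [← mul_smul, ← inv_smul_eq_iff, ← mul_smul]
  refine hm _ ?_
  rw [mul_smul, hs, inv_smul_eq_iff, mul_smul, hs]

end IsCircularlyUltrahomogeneous

/-! ### Arcs adapted to finite sets -/

theorem exists_finset_cut {X : Type*} [CircularOrder X] (x : X) (F : Finset X) :
    ∃ F' : Finset (Cut x), ∀ y : Cut x, y ∈ F' ↔ y.1 ∈ F :=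
  ⟨(F.finite_toSet.preimage (Subtype.val_injective (p := fun y => y ≠ x)).injOn).toFinset,
    fun _ => Set.Finite.mem_toFinset _⟩

theorem SBtw.sbtw.insert {X : Type*} [CircularOrder X] {a b c d : X} (h : sbtw a b d)
    (h' : sbtw b c d) : sbtw a b c ∧ sbtw a c d :=
  ⟨Cut.sbtw_of_lt (x := d) (a := ⟨a, h.ne₃₁.symm⟩) (b := ⟨b, h.ne₂₃⟩) (c := ⟨c, h'.ne₂₃⟩)
    h.cyclic_right h'.cyclic_right, h.trans_left h'⟩

namespace IsCircularlyUltrahomogeneous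

section Order

variable {G X : Type*} [Group G] [CircularOrder X] [MulAction G X]

theorem exists_smul_four (hX : IsCircularlyUltrahomogeneous G X) {a b c d a' b' c' d' : X}
    (h₁ : sbtw a b c) (h₂ : sbtw a c d) (h₁' : sbtw a' b' c') (h₂' : sbtw a' c' d') :
    ∃ g : G, g • a = a' ∧ g • b = b' ∧ g • c = c' ∧ g • d = d' := by
  obtain ⟨s, rfl⟩ := hX.exists_smul_point a a'
  replace h₁ := hX.smul_sbtw s _ _ _ h₁
  replace h₂ := hX.smul_sbtw s _ _ _ h₂
  have mono {p b c d : X} (h₁ : sbtw p b c) (h₂ : sbtw p c d) :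
      StrictMono (![⟨b, h₁.ne₁₂.symm⟩, ⟨c, h₂.ne₁₂.symm⟩, ⟨d, h₂.ne₃₁⟩] : Fin 3 → Cut p) := by
    refine Fin.strictMono_iff_lt_succ.2 fun i => ?_
    fin_cases i
    exacts [h₁, h₂]
  obtain ⟨g, hg, h⟩ := hX.exists_smul_eq_of_strictMono (mono h₁ h₂) (mono h₁' h₂')
  refine ⟨g * s, ?_, ?_, ?_, ?_⟩ <;> rw [mul_smul]
  exacts [hg, h 0, h 1, h 2]

theorem exists_cIoo_right (hX : IsCircularlyUltrahomogeneous G X) (a : X) (F : Finset X) :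
    ∃ b, b ≠ a ∧ ∀ f ∈ F, ¬ sbtw a f b := by
  obtain ⟨F', hF'⟩ := exists_finset_cut a F
  have := hX.nonempty_cut a
  obtain ⟨b, hb⟩ := (F'.exists_le (α := (Cut a)ᵒᵈ))
  exact ⟨b.1, b.2, fun f hf h => (hb ⟨f, h.ne₁₂.symm⟩ ((hF' _).2 hf)).not_gt h⟩

theorem exists_cIoo_left (hX : IsCircularlyUltrahomogeneous G X) (a : X) (F : Finset X) :
    ∃ b, b ≠ a ∧ ∀ f ∈ F, ¬ sbtw b f a := by
  obtain ⟨F', hF'⟩ := exists_finset_cut a F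
  have := hX.nonempty_cut a
  obtain ⟨b, hb⟩ := F'.exists_le
  exact ⟨b.1, b.2, fun f hf h => (hb ⟨f, h.ne₂₃⟩ ((hF' _).2 hf)).not_gt
    (SBtw.sbtw.cyclic_right h)⟩

/-- A point outside a finite set is contained in a small interval. -/
theorem exists_cIoo_mem (hX : IsCircularlyUltrahomogeneous G X) {x : X} {F : Finset X}
    (hx : x ∉ F) : ∃ c d, sbtw c x d ∧ ∀ f ∈ F, sbtw d f c := by
  obtain ⟨F', hF'⟩ := exists_finset_cut x F
  have := hX.nonempty_cut x
  have := hX.noMaxOrder_cut x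
  have := hX.noMinOrder_cut x
  obtain ⟨c, hc⟩ := F'.exists_le
  obtain ⟨d, hd⟩ := (F'.exists_le (α := (Cut x)ᵒᵈ))
  obtain ⟨d', hd'⟩ := exists_lt (min c d)
  obtain ⟨c', hc'⟩ := exists_gt (max c d)
  refine ⟨c'.1, d'.1, SBtw.sbtw.cyclic_right (show d' < c' from ?_), fun f hf => ?_⟩
  · exact hd'.trans (min_le_max.trans_lt hc')
  · have hfx : f ≠ x := by rintro rfl; exact hx hf
    have hf' : ⟨f, hfx⟩ ∈ F' := (hF' _).2 hf
    exact Cut.sbtw_of_lt (a := d') (b := ⟨f, hfx⟩) (c := c')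
      ((hd'.trans_le (min_le_right _ _)).trans_le (hd _ hf'))
      ((hc _ hf').trans_lt ((le_max_left _ _).trans_lt hc'))

/-- Cut at `y`, the arc around `y` runs from the maximum of `F` through `y` to its minimum. -/
theorem exists_cIoo_component {F : Finset X} (hF : F.Nontrivial) {y : X} (hy : y ∉ F) :
    ∃ a ∈ F, ∃ b ∈ F, sbtw a y b ∧ ∀ f ∈ F, ¬ sbtw a f b := by
  obtain ⟨F', hF'⟩ := exists_finset_cut y F
  obtain ⟨s, hs, t, ht, hst⟩ := hF
  have hsy : s ≠ y := by rintro rfl; exact hy hs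
  have hty : t ≠ y := by rintro rfl; exact hy ht
  have hs' : ⟨s, hsy⟩ ∈ F' := (hF' _).2 hs
  have ht' : ⟨t, hty⟩ ∈ F' := (hF' _).2 ht
  have hlt := F'.min'_lt_max' hs' ht' (fun e => hst (congrArg Subtype.val e))
  refine ⟨(F'.max' ⟨_, hs'⟩).1, (hF' _).1 (F'.max'_mem _), (F'.min' ⟨_, hs'⟩).1,
    (hF' _).1 (F'.min'_mem _), SBtw.sbtw.cyclic_right hlt, fun f hf h => ?_⟩
  have hfy : f ≠ y := by rintro rfl; exact hy hf
  have hf' : ⟨f, hfy⟩ ∈ F' := (hF' _).2 hf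
  have h1 := F'.min'_le _ hf'
  have h2 := F'.le_max' _ hf'
  rcases (Cut.sbtw_iff (b := ⟨f, hfy⟩)).1 h with ⟨h3, -⟩ | ⟨h3, -⟩ | ⟨-, h3⟩
  · exact h2.not_gt h3
  · exact h1.not_gt h3
  · exact h2.not_gt h3

end Order

/-! ### Limits of an equivariant map along arcs -/

section System

variable {G X M : Type*} [Group G] [CircularOrder X] [MulAction G X]
  [TopologicalSpace G] [TopologicalSpace M] [MulAction G M] {f : X → M}

omit [TopologicalSpace G] in
-- In a finite system `f` identifies two points, hence all by double transitivity; its value is then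
-- a fixed point with dense orbit.
theorem infinite_of_equivariant (hX : IsCircularlyUltrahomogeneous G X) [T2Space M]
    [MulAction.IsMinimal G M] [Nontrivial M] (hf : ∀ (g : G) (x : X), f (g • x) = g • f x) :
    Infinite M := by
  have := hX.infinite
  by_contra hfin
  rw [not_infinite_iff_finite] at hfin
  obtain ⟨x, y, hxy, he⟩ := Finite.exists_ne_map_eq_of_infinite f
  have hconst (a b : X) : f a = f b := by
    by_cases hab : a = b
    · rw [hab]
    · obtain ⟨g, rfl, rfl⟩ := hX.exists_smul_pair hxy hab
      rw [hf, hf, he]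
  obtain ⟨w, hw⟩ := exists_ne (f x)
  obtain ⟨_, ⟨g, rfl⟩, h2⟩ := (MulAction.dense_orbit G (f x)).exists_mem_open
    (isOpen_discrete {w}) ⟨w, rfl⟩
  exact hw (by rw [hconst x (g • x), hf]; exact (h2 : g • f x = w).symm)

theorem nhdsNE_neBot (hX : IsCircularlyUltrahomogeneous G X) [T2Space M] [CompactSpace M]
    [ContinuousSMul G M] [MulAction.IsMinimal G M] [Nontrivial M]
    (hf : ∀ (g : G) (x : X), f (g • x) = g • f x) (z : M) : (𝓝[≠] z).NeBot := by
  have := hX.infinite_of_equivariant hf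
  by_contra h
  have hz : IsOpen {z} := isOpen_singleton_iff_punctured_nhds z |>.2 (Filter.not_neBot.1 h)
  obtain ⟨I, hI⟩ := (isCompact_univ (X := M)).exists_finite_cover_smul G hz ⟨z, rfl⟩
  exact infinite_univ ((I.finite_toSet.biUnion fun g _ => (finite_singleton z).smul_set).subset hI)

omit [CircularOrder X] [TopologicalSpace G] in
theorem denseRange_of_equivariant [Nonempty X] [MulAction.IsMinimal G M]
    (hf : ∀ (g : G) (x : X), f (g • x) = g • f x) : DenseRange f := by
  obtain ⟨x⟩ := ‹Nonempty X›
  refine (MulAction.dense_orbit G (f x)).mono ?_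
  rintro _ ⟨g, rfl⟩
  exact ⟨g • x, hf g x⟩

omit [CircularOrder X] in
-- Choose `F` so that its stabilizer moves no point of `closure U` into `closure U'`, for
-- neighbourhoods of `z` and `z'`. Were both limits, an element of it would do so.
theorem exists_finset_separating (hG : ‹TopologicalSpace G› = pointwiseTopology G X)
    [T2Space M] [CompactSpace M] [ContinuousSMul G M]
    (hf : ∀ (g : G) (x : X), f (g • x) = g • f x) {z z' : M} (hz : z ≠ z') :
    ∃ F : Finset X, ∀ A : Set X,
      (∀ y ∈ A, ∀ y' ∈ A, ∃ g : G, (∀ x ∈ F, g • x = x) ∧ g • y = y') →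
      z ∈ closure (f '' A) → z' ∉ closure (f '' A) := by
  obtain ⟨U, hzU, hU, U', hzU', hU', hd⟩ := exists_open_nhds_disjoint_closure hz
  obtain ⟨F, hF⟩ := exists_finset_smul_subset (G := G) (X := X) hG
    (isClosed_closure (s := U)).isCompact (isClosed_closure (s := U')).isOpen_compl
    (disjoint_left.1 hd)
  refine ⟨F, fun A hA h h' => ?_⟩
  obtain ⟨_, hy, y, hyA, rfl⟩ := mem_closure_iff.1 h U hU hzU
  obtain ⟨_, hy', y', hyA', rfl⟩ := mem_closure_iff.1 h' U' hU' hzU'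
  obtain ⟨g, hg, rfl⟩ := hA y hyA y' hyA'
  exact hF g hg _ (subset_closure hy) (subset_closure (hf g y ▸ hy'))

/-- The points of a system that are the image of `a`, or its limit from one of the two sides. -/
def limitsAt (f : X → M) (a : X) : Set M :=
  {f a} ∪ (⋂ b ∈ ({a}ᶜ : Set X), closure (f '' cIoo a b)) ∪
    ⋂ b ∈ ({a}ᶜ : Set X), closure (f '' cIoo b a)

theorem countable_limitsAt (hX : IsCircularlyUltrahomogeneous G X)
    (hG : ‹TopologicalSpace G› = pointwiseTopology G X)
    [T2Space M] [CompactSpace M] [ContinuousSMul G M]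
    (hf : ∀ (g : G) (x : X), f (g • x) = g • f x) (a : X) : (limitsAt f a).Countable := by
  refine ((countable_singleton _).union (Set.Subsingleton.countable ?_)).union
    (Set.Subsingleton.countable ?_)
  · intro z hz z' hz'
    by_contra hne
    obtain ⟨F, hF⟩ := exists_finset_separating hG hf hne
    obtain ⟨b, hb, hbF⟩ := hX.exists_cIoo_right a F
    exact hF (cIoo a b) (fun y hy y' hy' => hX.exists_smul_eq_of_mem_cIoo hbF hy hy')
      (mem_iInter₂.1 hz b hb) (mem_iInter₂.1 hz' b hb)
  · intro z hz z' hz'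
    by_contra hne
    obtain ⟨F, hF⟩ := exists_finset_separating hG hf hne
    obtain ⟨b, hb, hbF⟩ := hX.exists_cIoo_left a F
    exact hF (cIoo b a) (fun y hy y' hy' => hX.exists_smul_eq_of_mem_cIoo hbF hy hy')
      (mem_iInter₂.1 hz b hb) (mem_iInter₂.1 hz' b hb)

omit [TopologicalSpace G] [MulAction G M] in
theorem exists_mem_closure_cIoo (hX : IsCircularlyUltrahomogeneous G X) [T2Space M]
    (hf : DenseRange f) {z : M} (hz : z ∉ range f) (F : Finset X) :
    ∃ a b, a ≠ b ∧ z ∈ closure (f '' cIoo a b) ∧ ∀ x ∈ F, ¬ sbtw a x b := by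
  classical
  have := hX.infinite
  obtain ⟨s, t, hst⟩ := exists_pair_ne X
  -- The two extra points ensure that the complementary arcs have distinct endpoints.
  let F' := insert s (insert t F)
  have hF' : F'.Nontrivial := ⟨s, by simp [F'], t, by simp [F'], hst⟩
  let J : Set (X × X) := {r | r.1 ∈ F' ∧ r.2 ∈ F' ∧ r.1 ≠ r.2 ∧ ∀ x ∈ F', ¬ sbtw r.1 x r.2}
  have hJ : J.Finite := (F'.finite_toSet.prod F'.finite_toSet).subset fun r hr => ⟨hr.1, hr.2.1⟩
  have hcov : range f ⊆ f '' F' ∪ ⋃ r ∈ J, f '' cIoo r.1 r.2 := by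
    rintro _ ⟨y, rfl⟩
    by_cases hy : y ∈ F'
    · exact Or.inl ⟨y, hy, rfl⟩
    · obtain ⟨a, ha, b, hb, hab, hc⟩ := exists_cIoo_component hF' hy
      exact Or.inr (mem_biUnion (show (a, b) ∈ J from ⟨ha, hb, hab.ne₃₁.symm, hc⟩) ⟨y, hab, rfl⟩)
  have hz' := closure_mono hcov (hf z)
  rw [closure_union, hJ.closure_biUnion, (F'.finite_toSet.image f).isClosed.closure_eq] at hz'
  rcases hz' with ⟨x, -, hx⟩ | hz'
  · exact (hz ⟨x, hx⟩).elim
  · obtain ⟨r, hr, hzr⟩ := mem_iUnion₂.1 hz'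
    exact ⟨r.1, r.2, hr.2.2.1, hzr, fun x hx => hr.2.2.2 x (by simp [F', hx])⟩

omit [CircularOrder X] in
theorem mem_closure_image_or {A B : Set X} {z : M} {C : Set X} (hz : z ∈ closure (f '' C))
    (h : C ⊆ A ∪ B) : z ∈ closure (f '' A) ∨ z ∈ closure (f '' B) := by
  rw [← mem_union, ← closure_union, ← image_union]
  exact closure_mono (image_mono h) hz

/-- A point which is not a one-sided limit is separated from any other point by four points
of the circular order. -/
theorem exists_separating (hX : IsCircularlyUltrahomogeneous G X)
    (hG : ‹TopologicalSpace G› = pointwiseTopology G X)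
    [T2Space M] [CompactSpace M] [ContinuousSMul G M] [MulAction.IsMinimal G M]
    (hf : ∀ (g : G) (x : X), f (g • x) = g • f x) {z z' : M} (hz : ∀ a, z ∉ limitsAt f a)
    (hne : z ≠ z') : ∃ a b c d, sbtw a b c ∧ sbtw a c d ∧ z ∈ closure (f '' cIoo a b) ∧
      z' ∈ closure (f '' cIoo c d) := by
  have := hX.infinite
  have hd := denseRange_of_equivariant hf
  have hzf (x : X) : z ∉ closure (f '' {x}) := fun h => by
    rw [image_singleton, closure_singleton] at h
    exact hz x (Or.inl (Or.inl h))
  obtain ⟨F, hF⟩ := exists_finset_separating hG hf hne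
  obtain ⟨a, b, hab, hzab, hFab⟩ := hX.exists_mem_closure_cIoo hd
    (fun ⟨x, hx⟩ => hz x (Or.inl (Or.inl hx.symm))) F
  -- As `z` is no one-sided limit, the arc can be shortened at `a`, and later at `b`, with `z` still
  -- a limit along it.
  obtain ⟨c, hca, hzc⟩ : ∃ c, c ≠ a ∧ z ∉ closure (f '' cIoo a c) := by
    by_contra! h
    exact hz a (Or.inl (Or.inr (mem_iInter₂.2 h)))
  have hacb : sbtw a c b := by
    by_contra h
    refine hzc (closure_mono (image_mono fun y hy => ?_) hzab)
    by_cases hcb : c = b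
    · rwa [hcb]
    · exact SBtw.sbtw.trans_right hy
        (((sbtw_or_sbtw_of_ne hca.symm hcb hab.symm).resolve_left h).cyclic_right)
  have hzcb : z ∈ closure (f '' cIoo c b) := by
    refine ((mem_closure_image_or hzab (A := cIoo a c) (B := {c} ∪ cIoo c b)
      fun y hy => ?_).resolve_left hzc |> fun h =>
        mem_closure_image_or h subset_rfl).resolve_left (hzf c)
    by_cases hyc : y = c
    · exact Or.inr (Or.inl hyc)
    · rcases sbtw_or_sbtw_of_ne (SBtw.sbtw.ne₁₂ hy) hyc hca with h | h
      · exact Or.inl h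
      · exact Or.inr (Or.inr (Cut.sbtw_of_lt (x := a) (a := ⟨c, hca⟩)
          (b := ⟨y, (SBtw.sbtw.ne₁₂ hy).symm⟩) (c := ⟨b, hab.symm⟩) h.cyclic_right hy))
  obtain ⟨d, hdb, hzd⟩ : ∃ d, d ≠ b ∧ z ∉ closure (f '' cIoo d b) := by
    by_contra! h
    exact hz b (Or.inr (mem_iInter₂.2 h))
  have hcdb : sbtw c d b := by
    by_contra h
    refine hzd (closure_mono (image_mono fun y hy => ?_) hzcb)
    by_cases hcd : c = d
    · rwa [← hcd]
    · exact SBtw.sbtw.trans_left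
        (((sbtw_or_sbtw_of_ne hcd hdb hacb.ne₂₃.symm).resolve_left h).cyclic_left) hy
  have hzcd : z ∈ closure (f '' cIoo c d) := by
    refine ((mem_closure_image_or hzcb (A := cIoo d b) (B := {d} ∪ cIoo c d)
      fun y hy => ?_).resolve_left hzd |> fun h =>
        mem_closure_image_or h subset_rfl).resolve_left (hzf d)
    by_cases hyd : y = d
    · exact Or.inr (Or.inl hyd)
    · rcases sbtw_or_sbtw_of_ne (SBtw.sbtw.ne₁₂ hy) hyd hcdb.ne₁₂.symm with h | h
      · exact Or.inr (Or.inr h)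
      · exact Or.inl (Cut.sbtw_of_lt (x := c) (a := ⟨d, hcdb.ne₁₂.symm⟩)
          (b := ⟨y, (SBtw.sbtw.ne₁₂ hy).symm⟩) (c := ⟨b, hcdb.ne₃₁⟩) h.cyclic_right hy)
  obtain ⟨p, hp⟩ := hX.exists_sbtw hca.symm
  obtain ⟨q, hq⟩ := hX.exists_sbtw hdb
  let A (y : X) (h : y ≠ a) : Cut a := ⟨y, h⟩
  have hcda := hacb.insert hcdb
  have hdqa := hcda.2.insert hq
  have hda : d ≠ a := hcda.2.ne₁₂.symm
  have hqa : q ≠ a := hdqa.2.ne₁₂.symm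
  have hcd : A c hca < A d hda := hcda.1
  have hdq : A d hda < A q hqa := hdqa.1
  have hqb : A q hqa < A b hab.symm := hdqa.2
  have hpc : A p hp.ne₁₂.symm < A c hca := hp
  refine ⟨c, d, q, p, Cut.sbtw_of_lt hcd hdq,
    (Cut.sbtw_of_lt hpc (hcd.trans hdq)).cyclic_left, hzcd, ?_⟩
  -- `z'` is not a limit along `(a, b)`, and `(a, b)` and `(q, p)` cover `X`.
  have hz' := hF (cIoo a b) (fun y hy y' hy' => hX.exists_smul_eq_of_mem_cIoo hFab hy hy') hzab
  refine (mem_closure_image_or (C := univ) (B := cIoo q p) (by simpa using hd z') fun y _ => ?_).resolve_left hz'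
  by_cases hy : sbtw a y b
  · exact Or.inl hy
  refine Or.inr ?_
  by_cases hya : y = a
  · subst hya
    exact SBtw.sbtw.cyclic_right (hpc.trans (hcd.trans hdq))
  · have hby : A b hab.symm ≤ A y hya := not_lt.1 hy
    exact (Cut.sbtw_of_lt (hpc.trans (hcd.trans hdq)) (hqb.trans_le hby)).cyclic_left

/-- A minimal system in which two disjoint intervals of the circular order have a common limit
is trivial. -/
theorem subsingleton_of_mem_closure (hX : IsCircularlyUltrahomogeneous G X)
    (hG : ‹TopologicalSpace G› = pointwiseTopology G X)
    [T2Space M] [CompactSpace M] [ContinuousSMul G M] [MulAction.IsMinimal G M]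
    (hf : ∀ (g : G) (x : X), f (g • x) = g • f x) {a b c d : X} (habc : sbtw a b c)
    (hacd : sbtw a c d) {w : M} (hw : w ∈ closure (f '' cIoo a b))
    (hw' : w ∈ closure (f '' cIoo c d)) : Subsingleton M := by
  classical
  by_contra hns
  rw [not_subsingleton_iff_nontrivial] at hns
  have := hX.infinite
  have hne := hX.nhdsNE_neBot hf
  have hd := denseRange_of_equivariant hf
  -- With no isolated points, the range of `f` stays dense after removing finitely many values.
  have hdF (F : Finset X) {V : Set M} {y : M} (hV : V ∈ 𝓝 y) : ∃ x ∉ F, f x ∈ V := by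
    obtain ⟨_, ⟨⟨x, rfl⟩, hx⟩, hxV⟩ :=
      (hd.sdiff_finset (F.image f)).inter_nhds_nonempty hV
    exact ⟨x, fun h => hx (Finset.mem_coe.2 (Finset.mem_image_of_mem f h)), hxV⟩
  obtain ⟨y₁, y₂, hy⟩ := exists_pair_ne M
  obtain ⟨W₁, hy₁, hW₁, W₂, hy₂, hW₂, hdisj⟩ := exists_open_nhds_disjoint_closure hy
  obtain ⟨C₁, hC₁, hCW₁, hc₁⟩ := local_compact_nhds (hW₁.mem_nhds hy₁)
  obtain ⟨C₂, hC₂, hCW₂, hc₂⟩ := local_compact_nhds (hW₂.mem_nhds hy₂)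
  obtain ⟨F₁, hF₁⟩ := exists_finset_smul_subset (G := G) (X := X) hG hc₁ hW₁ hCW₁
  obtain ⟨F₂, hF₂⟩ := exists_finset_smul_subset (G := G) (X := X) hG hc₂ hW₂ hCW₂
  obtain ⟨x₁, hx₁, hxC₁⟩ := hdF (F₁ ∪ F₂) hC₁
  obtain ⟨x₂, hx₂, hxC₂⟩ := hdF (insert x₁ (F₁ ∪ F₂)) hC₂
  simp only [Finset.mem_insert, Finset.mem_union, not_or] at hx₁ hx₂
  -- An arc around `x₁` missing `F₁` is mapped into `W₁`, and likewise at `x₂`; the second arc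
  -- avoids `p` and `q`, making the two disjoint.
  obtain ⟨p, q, hpq, hpqF⟩ := hX.exists_cIoo_mem (x := x₁) (F := insert x₂ F₁)
    (by simp [hx₁.1, Ne.symm hx₂.1])
  have hqp := hpqF x₂ (by simp)
  obtain ⟨r, s, hrs, hrsF⟩ := hX.exists_cIoo_mem (x := x₂) (F := insert p (insert q F₂))
    (by simp [hx₂.2.2, hqp.ne₁₂.symm, hqp.ne₂₃])
  have hsub {C W : Set M} {F : Finset X} (hF : ∀ g : G, (∀ f ∈ F, g • f = f) → ∀ w ∈ C, g • w ∈ W)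
      {x p q : X} (hx : f x ∈ C) (hpq : sbtw p x q) (hpqF : ∀ f ∈ F, sbtw q f p) :
      f '' cIoo p q ⊆ W := by
    rintro _ ⟨y, hy, rfl⟩
    obtain ⟨g, hg, rfl⟩ := hX.exists_smul_eq_of_mem_cIoo
      (fun f hf h => h.not_sbtw (hpqF f hf)) hpq hy
    rw [hf]
    exact hF g hg _ hx
  have h₁ := hsub hF₁ hxC₁ hpq fun f hf => hpqF f (by simp [hf])
  have h₂ := hsub hF₂ hxC₂ hrs fun f hf => hrsF f (by simp [hf])
  have hsr : sbtw x₂ s r := hrs.cyclic_left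
  have hpq' : sbtw x₂ p q := hqp.cyclic_left
  let A (y : X) (h : y ≠ x₂) : Cut x₂ := ⟨y, h⟩
  have hspr : sbtw s p r := hrsF p (by simp)
  have hsqr : sbtw s q r := hrsF q (by simp)
  have hsp : A s hrs.ne₂₃.symm < A p hqp.ne₂₃.symm := by
    rcases (Cut.sbtw_iff (a := A s hrs.ne₂₃.symm) (b := A p hqp.ne₂₃.symm)
      (c := A r hrs.ne₁₂)).1 hspr with h | h | h
    exacts [h.1, (lt_asymm h.2 hsr).elim, h.2]
  have hqr : A q hqp.ne₁₂ < A r hrs.ne₁₂ := by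
    rcases (Cut.sbtw_iff (a := A s hrs.ne₂₃.symm) (b := A q hqp.ne₁₂)
      (c := A r hrs.ne₁₂)).1 hsqr with h | h | h
    exacts [h.2, h.1, (lt_asymm h.1 hsr).elim]
  have hpq'' : A p hqp.ne₂₃.symm < A q hqp.ne₁₂ := hpq'
  obtain ⟨g, rfl, rfl, rfl, rfl⟩ := hX.exists_smul_four habc hacd
    (Cut.sbtw_of_lt hpq'' hqr) (Cut.sbtw_of_lt hsp (hpq''.trans hqr)).cyclic_left
  have hmem {a b : X} (hw : w ∈ closure (f '' cIoo a b)) :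
      g • w ∈ closure (f '' cIoo (g • a) (g • b)) := by
    refine map_mem_closure (continuous_const_smul g) hw ?_
    rintro _ ⟨y, hy, rfl⟩
    exact ⟨g • y, hX.smul_sbtw g _ _ _ hy, hf g y⟩
  exact disjoint_left.1 hdisj (closure_mono h₁ (hmem hw)) (closure_mono h₂ (hmem hw'))

end System

end IsCircularlyUltrahomogeneous

/-! ### Passage to the factor -/

theorem IsFactorMap.isMinimal {G Z Y : Type*} [Group G] [TopologicalSpace Z]
    [TopologicalSpace Y] [MulAction G Z] [MulAction G Y] [MulAction.IsMinimal G Z] {p : Z → Y}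
    (hp : IsFactorMap G p) : MulAction.IsMinimal G Y := by
  refine ⟨fun y => ?_⟩
  obtain ⟨z, rfl⟩ := hp.surjective y
  refine (hp.surjective.denseRange.dense_image hp.continuous (MulAction.dense_orbit G z)).mono ?_
  rintro _ ⟨_, ⟨g, rfl⟩, rfl⟩
  exact ⟨g, (hp.map_smul g z).symm⟩

theorem corollary4p9 {G : Type*} {X : Type*} {M : Type*} {Y : Type*}
    [Group G] [CircularOrder X] [Countable X] [MulAction G X]
    (hX : IsCircularlyUltrahomogeneous G X)
    [TopologicalSpace G] (hG : ‹TopologicalSpace G› = pointwiseTopology G X)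
    [TopologicalSpace M] [MulAction G M] (hM : IsUniversalMinimalSystem G M)
    [TopologicalSpace Y] [T2Space Y] [CompactSpace Y] [MulAction G Y] [ContinuousSMul G Y]
    [Nontrivial Y] (p : M → Y) (hp : IsFactorMap G p) :
    ∃ Z₀ : Set M, IsGδ Z₀ ∧ Dense Z₀ ∧ ∀ z ∈ Z₀, p ⁻¹' {p z} = {z} := by
  obtain ⟨_, _, _, _, _⟩ := hM.isMinimalSystem
  have := hp.isMinimal
  have : Nontrivial M := hp.surjective.nontrivial
  obtain ⟨f, hf⟩ := hX.exists_equivariant hG M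
  have hne := hX.nhdsNE_neBot hf
  have hc : (⋃ a, IsCircularlyUltrahomogeneous.limitsAt f a).Countable :=
    countable_iUnion fun a => hX.countable_limitsAt hG hf a
  refine ⟨_, hc.isGδ_compl, ?_, fun z hz => ?_⟩
  · rw [← biUnion_of_singleton (⋃ a, IsCircularlyUltrahomogeneous.limitsAt f a)]
    simp only [compl_iUnion₂]
    exact dense_biInter_of_isOpen (fun z _ => isOpen_compl_singleton) hc
      fun z _ => dense_compl_singleton z
  have hz' : ∀ a, z ∉ IsCircularlyUltrahomogeneous.limitsAt f a := fun a ha =>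
    hz (mem_iUnion.2 ⟨a, ha⟩)
  refine Subset.antisymm (fun z' hpz => ?_) (by simp)
  by_contra hzz
  obtain ⟨a, b, c, d, habc, hacd, h₁, h₂⟩ := hX.exists_separating hG hf hz' (Ne.symm hzz)
  have key {z : M} {A : Set X} (h : z ∈ closure (f '' A)) : p z ∈ closure ((p ∘ f) '' A) := by
    rw [image_comp]
    exact map_mem_closure hp.continuous h (mapsTo_image p _)
  -- The arcs separate `z` from `z'` in `M`, but in `Y` both limits along `p ∘ f` are `p z`.
  refine not_subsingleton Y (hX.subsingleton_of_mem_closure hG (f := p ∘ f)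
    (fun g x => by simp [hf, hp.map_smul]) habc hacd (key h₁) ?_)
  rw [← show p z' = p z from hpz]
  exact key h₂
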